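/- An MV-algebra is a structure $(A,\oplus,\neg,0)$ such that $(A,\oplus,0)$ is a commutative monoid, $\neg\neg x=x$, $x\oplus\neg 0=\neg 0$ and $\neg(\neg x\oplus y)\oplus y=\neg(\neg y\oplus x)\oplus x$. Write $x\ominus y=\neg(\neg x\oplus y)$, and $x\le y$ if $\neg(\neg x\oplus y)\oplus y=y$. An MV-ideal is a subset of $A$ that contains $0$, is closed under $\oplus$ and is a downset for $\le$. An MV-ideal $I$ is prime if $I\ne A$ and, for all $a,b\in A$, $a\ominus b\in I$ or $b\ominus a\in I$; it is maximal if $I\neq A$ and $A$ is the only MV-ideal properly containing $I$. The quotient $A/I$ is the MV-algebra of classes for the congruence $a\sim b\iff a\ominus b,\ b\ominus a\in I$. Let $A$ be an MV-algebra. Let $Z$ be the set of maximal MV-ideals $I_z$ of $A$, with the spectral topology $\tau^\downarrow$, generated by the sets $\{z\in Z\mid a\notin I_z\}$ for $a\in A$. For $z\in Z$ let $\mathfrak o_z$ be the germinal MV-ideal at $z$, that is, the intersection of all prime MV-ideals contained in $I_z$. Let $E$ be the disjoint union of the sets $A/\mathfrak o_z$, $z\in Z$, with projection $p\colon E\to Z$;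 for $a\in A$ let $s_a\colon Z\to E$ send $z$ to the class of $a$ in $A/\mathfrak o_z$; and give $E$ the topology generated by the sets $s_a(U)$, for $a\in A$ and $U\subseteq Z$ open. Then: 1. $(Z,\tau^\downarrow)$ is a compact Hausdorff space. 2. $p\colon E\to Z$ is an étale space (a local homeomorphism), and for each open $U\subseteq Z$ the continuous sections of $p$ over $U$ are closed under the pointwise MV-operations. 3. For each $z\in Z$ the stalk at $z$ is $A/\mathfrak o_z$: every element of $A/\mathfrak o_z$ is the value at $z$ of a continuous section over an open neighbourhood of $z$, and two continuous sections over open neighbourhoods $U$, $V$ of $z$ have the same value at $z$ if and only if they agree on some open $W$ with $z\in W\subseteq U\cap V$. 4. The set $\Gamma(E,p)$ of continuous global sections of $p$ is an MV-subalgebra of $\prod_{z\in Z}A/\mathfrak o_z$, and $a\mapsto s_a$ is an isomorphism of MV-algebras from $A$ onto $\Gamma(E,p)$. -/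

import Mathlib

open Set Topology

universe u v

/-- An MV-algebra `(A, ⊕ᴹ, ∼ᴹ, 0)`. -/
class MVAlgebra (A : Type u) where
  oplus : A → A → A
  neg : A → A
  zero : A
  oplus_assoc : ∀ x y z, oplus (oplus x y) z = oplus x (oplus y z)
  oplus_comm : ∀ x y, oplus x y = oplus y x
  oplus_zero : ∀ x, oplus x zero = x
  neg_invol : ∀ x, neg (neg x) = x
  oplus_neg_zero : ∀ x, oplus x (neg zero) = neg zero
  mv_law : ∀ x y, oplus (neg (oplus (neg x) y)) y = oplus (neg (oplus (neg y) x)) x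

infixl:65 " ⊕ᴹ " => MVAlgebra.oplus
prefix:max "∼ᴹ" => MVAlgebra.neg

namespace MVAlgebra

section Basic

variable {A : Type u} [MVAlgebra A]

/-- The top element `1 = ∼ᴹ0`. -/
def one : A := ∼ᴹ(zero : A)

/-- Truncated difference `x ⊖ y = ∼ᴹ(∼ᴹx ⊕ᴹ y)`. -/
def ominus (x y : A) : A := ∼ᴹ(∼ᴹx ⊕ᴹ y)

/-- The join `x ∨ y = ∼ᴹ(∼ᴹx ⊕ᴹ y) ⊕ᴹ y` of the underlying lattice. -/
def join (x y : A) : A := ∼ᴹ(∼ᴹx ⊕ᴹ y) ⊕ᴹ y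

/-- The order of the underlying lattice: `x ≤ y` iff `x ∨ y = y`. -/
def Le (x y : A) : Prop := join x y = y

theorem neg_one : ∼ᴹ(one : A) = zero := neg_invol _

theorem oplus_one (x : A) : x ⊕ᴹ one = one := oplus_neg_zero x

theorem zero_oplus (x : A) : zero ⊕ᴹ x = x := by rw [oplus_comm, oplus_zero]

theorem neg_oplus_self (x : A) : ∼ᴹx ⊕ᴹ x = one := by
  have h := mv_law x (one : A)
  rw [oplus_one, neg_one, zero_oplus] at h
  exact h.symm

theorem le_iff {x y : A} : Le x y ↔ ∼ᴹx ⊕ᴹ y = one := by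
  unfold Le join
  constructor
  · intro h
    rw [← h, mv_law, oplus_comm _ x, ← oplus_assoc, neg_oplus_self, oplus_comm, oplus_one]
  · intro h
    rw [h, neg_one, zero_oplus]

theorem le_refl (x : A) : Le x x := le_iff.2 (neg_oplus_self x)

theorem le_oplus_left (x w : A) : Le x (x ⊕ᴹ w) := by
  rw [le_iff, ← oplus_assoc, neg_oplus_self, oplus_comm, oplus_one]

theorem exists_of_le {x y : A} (h : Le x y) : ∃ w, y = x ⊕ᴹ w := by
  refine ⟨∼ᴹ(∼ᴹy ⊕ᴹ x), ?_⟩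
  rw [oplus_comm x, ← mv_law]
  exact h.symm

theorem le_trans {x y z : A} (h₁ : Le x y) (h₂ : Le y z) : Le x z := by
  obtain ⟨w, rfl⟩ := exists_of_le h₁
  obtain ⟨w', rfl⟩ := exists_of_le h₂
  rw [oplus_assoc]
  exact le_oplus_left _ _

theorem oplus_le_oplus {a b c d : A} (h₁ : Le a b) (h₂ : Le c d) : Le (a ⊕ᴹ c) (b ⊕ᴹ d) := by
  obtain ⟨w, rfl⟩ := exists_of_le h₁
  obtain ⟨w', rfl⟩ := exists_of_le h₂
  have : a ⊕ᴹ w ⊕ᴹ (c ⊕ᴹ w') = a ⊕ᴹ c ⊕ᴹ (w ⊕ᴹ w') := by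
    rw [oplus_assoc, ← oplus_assoc w c, oplus_comm w c, oplus_assoc c, ← oplus_assoc]
  rw [this]
  exact le_oplus_left _ _

theorem ominus_le_iff {a b c : A} : Le (ominus a b) c ↔ Le a (b ⊕ᴹ c) := by
  rw [le_iff, le_iff, ominus, neg_invol, oplus_assoc]

theorem ominus_self (a : A) : ominus a a = zero := by
  rw [ominus, neg_oplus_self, neg_one]

theorem neg_ominus_neg (a b : A) : ominus ∼ᴹa ∼ᴹb = ominus b a := by
  rw [ominus, ominus, neg_invol, oplus_comm]

theorem ominus_triangle (a b c : A) : Le (ominus a c) (ominus a b ⊕ᴹ ominus b c) := by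
  have h₁ : Le a (b ⊕ᴹ ominus a b) := ominus_le_iff.1 (le_refl _)
  have h₂ : Le b (c ⊕ᴹ ominus b c) := ominus_le_iff.1 (le_refl _)
  rw [ominus_le_iff]
  refine le_trans h₁ ?_
  rw [oplus_comm (ominus a b), ← oplus_assoc]
  exact oplus_le_oplus h₂ (le_refl _)

theorem oplus_ominus_oplus (a b c d : A) :
    Le (ominus (a ⊕ᴹ c) (b ⊕ᴹ d)) (ominus a b ⊕ᴹ ominus c d) := by
  have h₁ : Le a (b ⊕ᴹ ominus a b) := ominus_le_iff.1 (le_refl _)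
  have h₂ : Le c (d ⊕ᴹ ominus c d) := ominus_le_iff.1 (le_refl _)
  rw [ominus_le_iff]
  have h := oplus_le_oplus h₁ h₂
  rwa [oplus_assoc, ← oplus_assoc (ominus a b), oplus_comm (ominus a b) d, oplus_assoc d,
    ← oplus_assoc] at h

end Basic

/-- The product of a family of MV-algebras, with the pointwise operations. -/
instance pi {ι : Type u} (B : ι → Type v) [∀ i, MVAlgebra (B i)] : MVAlgebra (∀ i, B i) where
  oplus f g := fun i => f i ⊕ᴹ g i
  neg f := fun i => ∼ᴹ(f i)
  zero := fun _ => zero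
  oplus_assoc _ _ _ := funext fun _ => oplus_assoc _ _ _
  oplus_comm _ _ := funext fun _ => oplus_comm _ _
  oplus_zero _ := funext fun _ => oplus_zero _
  neg_invol _ := funext fun _ => neg_invol _
  oplus_neg_zero _ := funext fun _ => oplus_neg_zero _
  mv_law _ _ := funext fun _ => mv_law _ _

end MVAlgebra

section MVConstructions

open MVAlgebra

/-- An isomorphism of MV-algebras. -/
structure MVEquiv (A : Type u) (B : Type v) [MVAlgebra A] [MVAlgebra B] extends A ≃ B where
  map_oplus : ∀ a b, toFun (a ⊕ᴹ b) = toFun a ⊕ᴹ toFun b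
  map_neg : ∀ a, toFun ∼ᴹa = ∼ᴹ(toFun a)
  map_zero : toFun zero = zero

/-- A subalgebra of an MV-algebra. -/
structure MVSubalgebra (A : Type u) [MVAlgebra A] where
  carrier : Set A
  zero_mem : zero ∈ carrier
  oplus_mem : ∀ {a b}, a ∈ carrier → b ∈ carrier → a ⊕ᴹ b ∈ carrier
  neg_mem : ∀ {a}, a ∈ carrier → ∼ᴹa ∈ carrier

/-- A subalgebra is an MV-algebra under the restricted operations. -/
instance MVSubalgebra.mvAlgebra {A : Type u} [MVAlgebra A] (S : MVSubalgebra A) :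
    MVAlgebra S.carrier where
  oplus a b := ⟨a.1 ⊕ᴹ b.1, S.oplus_mem a.2 b.2⟩
  neg a := ⟨∼ᴹa.1, S.neg_mem a.2⟩
  zero := ⟨zero, S.zero_mem⟩
  oplus_assoc _ _ _ := Subtype.ext (oplus_assoc _ _ _)
  oplus_comm _ _ := Subtype.ext (oplus_comm _ _)
  oplus_zero _ := Subtype.ext (oplus_zero _)
  neg_invol _ := Subtype.ext (neg_invol _)
  oplus_neg_zero _ := Subtype.ext (oplus_neg_zero _)
  mv_law _ _ := Subtype.ext (mv_law _ _)

/-- An MV-ideal: a submonoid for `⊕ᴹ` that is a downset. -/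
@[ext]
structure MVIdeal (A : Type u) [MVAlgebra A] where
  carrier : Set A
  zero_mem : zero ∈ carrier
  oplus_mem : ∀ {a b}, a ∈ carrier → b ∈ carrier → a ⊕ᴹ b ∈ carrier
  down : ∀ {a b}, a ∈ carrier → Le b a → b ∈ carrier

namespace MVIdeal

variable {A : Type u} [MVAlgebra A]

/-- A prime MV-ideal: proper, and `a ⊖ b ∈ I` or `b ⊖ a ∈ I` for all `a`, `b`. -/
def IsPrime (I : MVIdeal A) : Prop :=
  I.carrier ≠ univ ∧ ∀ a b : A, ominus a b ∈ I.carrier ∨ ominus b a ∈ I.carrier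

/-- A maximal MV-ideal: proper, and the only MV-ideal properly containing it is `A`. -/
def IsMaximal (I : MVIdeal A) : Prop :=
  I.carrier ≠ univ ∧ ∀ J : MVIdeal A, I.carrier ⊂ J.carrier → J.carrier = univ

/-- The congruence of an MV-ideal: `a ~ b` iff `a ⊖ b ∈ I` and `b ⊖ a ∈ I`. -/
def congr (I : MVIdeal A) : Setoid A where
  r a b := ominus a b ∈ I.carrier ∧ ominus b a ∈ I.carrier
  iseqv :=
    { refl := fun a => by rw [ominus_self]; exact ⟨I.zero_mem, I.zero_mem⟩
      symm := fun h => ⟨h.2, h.1⟩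
      trans := fun {a b c} h k =>
        ⟨I.down (I.oplus_mem h.1 k.1) (ominus_triangle a b c),
          I.down (I.oplus_mem k.2 h.2) (ominus_triangle c b a)⟩ }

/-- The quotient `A/I`. -/
def Quot (I : MVIdeal A) : Type u := Quotient I.congr

/-- The class of `a` in `A/I`. -/
def toQuot (I : MVIdeal A) (a : A) : I.Quot := Quotient.mk I.congr a

/-- The quotient MV-algebra `A/I`, with the operations induced from `A`. -/
instance (I : MVIdeal A) : MVAlgebra I.Quot where
  oplus := Quotient.map₂ (fun a b => a ⊕ᴹ b) (fun a b h c d k =>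
    ⟨I.down (I.oplus_mem h.1 k.1) (oplus_ominus_oplus a b c d),
      I.down (I.oplus_mem h.2 k.2) (oplus_ominus_oplus b a d c)⟩)
  neg := Quotient.map (fun a => ∼ᴹa) (fun a b h => by
    change ominus ∼ᴹa ∼ᴹb ∈ I.carrier ∧ ominus ∼ᴹb ∼ᴹa ∈ I.carrier
    rw [neg_ominus_neg, neg_ominus_neg]
    exact ⟨h.2, h.1⟩)
  zero := I.toQuot zero
  oplus_assoc x y z := Quotient.inductionOn₃ x y z fun _ _ _ =>
    congrArg I.toQuot (oplus_assoc _ _ _)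
  oplus_comm x y := Quotient.inductionOn₂ x y fun _ _ => congrArg I.toQuot (oplus_comm _ _)
  oplus_zero x := Quotient.inductionOn x fun _ => congrArg I.toQuot (oplus_zero _)
  neg_invol x := Quotient.inductionOn x fun _ => congrArg I.toQuot (neg_invol _)
  oplus_neg_zero x := Quotient.inductionOn x fun _ => congrArg I.toQuot (oplus_neg_zero _)
  mv_law x y := Quotient.inductionOn₂ x y fun _ _ => congrArg I.toQuot (mv_law _ _)

end MVIdeal

/-- The maximal MV-spectrum `Z` of `A`: the set of maximal MV-ideals. -/
structure MaxMVSpec (A : Type u) [MVAlgebra A] where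
  ideal : MVIdeal A
  isMaximal : ideal.IsMaximal

namespace MaxMVSpec

variable {A : Type u} [MVAlgebra A]

/-- The spectral topology `τ↓` on `Z`, generated by the sets `{z | a ∉ I_z}` for `a ∈ A`. -/
instance : TopologicalSpace (MaxMVSpec A) :=
  TopologicalSpace.generateFrom {V | ∃ a : A, V = {z | a ∉ z.ideal.carrier}}

/-- The germinal MV-ideal at `z`: the intersection of the prime MV-ideals contained in `I_z`. -/
def germinal (z : MaxMVSpec A) : MVIdeal A where
  carrier := {a | ∀ P : MVIdeal A, P.IsPrime → P.carrier ⊆ z.ideal.carrier → a ∈ P.carrier}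
  zero_mem := fun P _ _ => P.zero_mem
  oplus_mem := fun ha hb P hP h => P.oplus_mem (ha P hP h) (hb P hP h)
  down := fun ha hba P hP h => P.down (ha P hP h) hba

/-- The fibre `A/𝔬_z` over `z`. -/
abbrev Fibre (z : MaxMVSpec A) : Type u := z.germinal.Quot

end MaxMVSpec

/-- The underlying set of the étale space: the disjoint union of the algebras `A/𝔬_z`. -/
structure GermSpace (A : Type u) [MVAlgebra A] where
  base : MaxMVSpec A
  val : base.Fibre

namespace GermSpace

variable {A : Type u} [MVAlgebra A]

/-- A family `f ∈ ∏ A/𝔬_z` regarded as a (not necessarily continuous) section `Z → E`. -/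
def toSection (f : ∀ z : MaxMVSpec A, z.Fibre) (z : MaxMVSpec A) : GermSpace A := ⟨z, f z⟩

/-- The family `([a])_z` of the classes of `a ∈ A` in the algebras `A/𝔬_z`. -/
def ofElem (a : A) (z : MaxMVSpec A) : z.Fibre := z.germinal.toQuot a

/-- The topology of the étale space, generated by the sets `s_a(U)`, for `U ⊆ Z` open and `s_a`
the section `z ↦ [a]` given by `a ∈ A`. -/
instance : TopologicalSpace (GermSpace A) :=
  TopologicalSpace.generateFrom
    {V | ∃ (a : A) (U : Set (MaxMVSpec A)), IsOpen U ∧ V = toSection (ofElem a) '' U}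

/-- `f` restricts to a continuous section of `base : GermSpace A → MaxMVSpec A` over `U`.
(All fibres are non-empty, so each section over `U` is the restriction of some `f`.) -/
def IsSectionOn (U : Set (MaxMVSpec A)) (f : ∀ z : MaxMVSpec A, z.Fibre) : Prop :=
  ContinuousOn (toSection f) U

end GermSpace

end MVConstructions

/-!
The elements of `A` orthogonal to a given set form an ideal, and `a ⊖ b` is orthogonal to `b ⊖ a`.
With polars in place of generated ideals, Zorn's lemma therefore yields the prime ideal theorem
`MVIdeal.exists_isPrime`: an ideal that misses a down-directed set extends to a prime ideal that
misses it. Hence maximal ideals are prime, the primes intersect in `0`, and an element lies in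
`𝔬_z` iff it is orthogonal to some `b ∉ I_z` (`MaxMVSpec.mem_germinal_iff`). By the last fact the
equaliser of two sections `s_a`, `s_b` is open, which gives the étale structure, and the
continuous sections are the families that locally have the form `s_a`
(`GermSpace.isSectionOn_iff`).

The substance is that every continuous global section is some `s_a`. For a closed `K ⊆ Z` let
`I_K` be the intersection of the `𝔬_z`, `z ∈ K`. If `P` is a prime containing `I_K` and `I_z` is
a maximal ideal above `P`, then `z ∈ K`, because a point outside `K` is separated from `K` by an
element of `I_K` (`MaxMVSpec.exists_mem_germinal_of_isClosed`). So a prime containing `I_K` and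
`I_L` contains `𝔬_z` for some `z ∈ K ∩ L`, and by the prime ideal theorem `I_{K ∩ L}` is contained
in `I_K + I_L`. If now `a` and `b` agree over `K ∩ L`, there are `i ∈ I_K` and `j ∈ I_L` with
`a ≤ b ⊕ i ⊕ j` and `b ≤ a ⊕ i ⊕ j`, and `(a ⊖ i) ∨ (b ⊖ j)` agrees with `a` over `K` and with `b`
over `L` (`MaxMVSpec.exists_glue`). As `Z` is compact and regular, finitely many such steps suffice.
-/

namespace MVAlgebra

variable {A : Type u} [MVAlgebra A]

/-! ### Order and residuation -/

theorem le_antisymm {x y : A} (h₁ : Le x y) (h₂ : Le y x) : x = y := by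
  have h := mv_law x y
  exact (h₁.symm.trans (h.trans h₂)).symm

theorem zero_le (x : A) : Le zero x := by
  have h := le_oplus_left zero x
  rwa [zero_oplus] at h

theorem le_one (x : A) : Le x one := by
  rw [le_iff, oplus_one]

theorem eq_zero_of_le {x : A} (h : Le x zero) : x = zero := le_antisymm h (zero_le x)

theorem le_oplus_right (x w : A) : Le x (w ⊕ᴹ x) := by
  rw [oplus_comm]
  exact le_oplus_left x w

theorem ominus_le (x y : A) : Le (ominus x y) x := ominus_le_iff.2 (le_oplus_right x y)

theorem le_oplus_ominus (x y : A) : Le x (y ⊕ᴹ ominus x y) := ominus_le_iff.1 (le_refl _)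

theorem ominus_eq_zero_iff {x y : A} : ominus x y = zero ↔ Le x y := by
  constructor
  · intro h
    have := le_oplus_ominus x y
    rwa [h, oplus_zero] at this
  · intro h
    apply eq_zero_of_le
    rwa [ominus_le_iff, oplus_zero]

theorem neg_le_neg {x y : A} (h : Le x y) : Le ∼ᴹy ∼ᴹx := by
  rw [le_iff, neg_invol, oplus_comm]
  exact le_iff.1 h

theorem le_join_left (x y : A) : Le x (join x y) := by
  have h := le_oplus_ominus x y
  rwa [oplus_comm] at h

theorem le_join_right (x y : A) : Le y (join x y) := le_oplus_right y _

theorem join_le {x y z : A} (hx : Le x z) (hy : Le y z) : Le (join x y) z := by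
  have h₁ : Le (ominus x y) (ominus z y) := ominus_le_iff.2 (le_trans hx (le_oplus_ominus z y))
  have h₂ : Le (join x y) (join z y) := oplus_le_oplus h₁ (le_refl y)
  have h₃ : join z y = z := (mv_law z y).trans hy
  rwa [h₃] at h₂

/-- The meet `x ∧ y = x ⊖ (x ⊖ y)` of the underlying lattice. -/
def meet (x y : A) : A := ominus x (ominus x y)

theorem meet_le_left (x y : A) : Le (meet x y) x := ominus_le _ _

theorem meet_le_right (x y : A) : Le (meet x y) y := by
  refine ominus_le_iff.2 ?_
  rw [oplus_comm]
  exact le_oplus_ominus x y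

theorem ominus_ominus_of_le {x y : A} (h : Le y x) : ominus x (ominus x y) = y := by
  have h₁ : join ∼ᴹx ∼ᴹy = ∼ᴹy := neg_le_neg h
  have h₂ : join ∼ᴹy ∼ᴹx = ∼ᴹy := (mv_law ∼ᴹy ∼ᴹx).trans h₁
  unfold join at h₂
  rw [neg_invol] at h₂
  rw [ominus, ominus, oplus_comm ∼ᴹx, oplus_comm ∼ᴹx, h₂, neg_invol]

theorem ominus_le_ominus_left {x y : A} (h : Le x y) (z : A) : Le (ominus z y) (ominus z x) := by
  refine ominus_le_iff.2 (le_trans (le_oplus_ominus z x) ?_)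
  exact oplus_le_oplus h (le_refl _)

theorem le_meet {x y z : A} (hx : Le z x) (hy : Le z y) : Le z (meet x y) := by
  rw [← ominus_ominus_of_le hx]
  exact ominus_le_ominus_left (ominus_le_ominus_left hy x) x

/-! ### Orthogonality -/

/-- `a` and `b` are orthogonal, `a ∧ b = 0`, stated as: `0` is their only common lower bound. -/
def Orth (a b : A) : Prop := ∀ x, Le x a → Le x b → x = zero

theorem Orth.symm {a b : A} (h : Orth a b) : Orth b a := fun x hb ha => h x ha hb

theorem Orth.mono_left {a a' b : A} (h : Orth a b) (ha : Le a' a) : Orth a' b :=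
  fun x h₁ h₂ => h x (le_trans h₁ ha) h₂

theorem Orth.oplus_left {a a' b : A} (h : Orth a b) (h' : Orth a' b) : Orth (a ⊕ᴹ a') b := by
  intro x hx hb
  have h₁ : ominus x a = zero :=
    h' _ (ominus_le_iff.2 hx) (le_trans (ominus_le x a) hb)
  exact h x (ominus_eq_zero_iff.1 h₁) hb

theorem zero_orth (b : A) : Orth zero b := fun _ hx _ => eq_zero_of_le hx

theorem orth_of_meet_eq_zero {a b : A} (h : meet a b = zero) : Orth a b := by
  intro x ha hb
  have hx := le_meet ha hb
  rw [h] at hx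
  exact eq_zero_of_le hx

/-- Prelinearity. With `s = x ∨ y`, a common lower bound `z` of `x ⊖ y` and `y ⊖ x` satisfies
`x, y ≤ s ⊖ z`, hence `s ≤ s ⊖ z`, and this forces `z = s ⊖ (s ⊖ z) = 0`. -/
theorem orth_ominus (x y : A) : Orth (ominus x y) (ominus y x) := by
  intro z hxy hyx
  have mono {a b c : A} (h : Le a b) : Le (ominus a c) (ominus b c) :=
    ominus_le_iff.2 (le_trans h (le_oplus_ominus b c))
  have h₁ : Le z (ominus (join x y) y) := le_trans hxy (mono (le_join_left x y))
  have h₂ : Le z (ominus (join x y) x) := le_trans hyx (mono (le_join_right x y))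
  have hy : Le y (ominus (join x y) z) := by
    have := ominus_le_ominus_left h₁ (join x y)
    rwa [ominus_ominus_of_le (le_join_right x y)] at this
  have hx : Le x (ominus (join x y) z) := by
    have := ominus_le_ominus_left h₂ (join x y)
    rwa [ominus_ominus_of_le (le_join_left x y)] at this
  have hz : Le z (join x y) := le_trans h₁ (ominus_le _ _)
  rw [← ominus_ominus_of_le hz]
  exact ominus_eq_zero_iff.2 (join_le hx hy)

end MVAlgebra

open MVAlgebra

namespace MVIdeal

variable {A : Type u} [MVAlgebra A]

/-! ### Ideals and the prime ideal theorem -/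

/-- The zero ideal. -/
def bot : MVIdeal A where
  carrier := {zero}
  zero_mem := rfl
  oplus_mem := by
    rintro a b rfl rfl
    exact oplus_zero _
  down := by
    rintro a b rfl h
    exact eq_zero_of_le h

/-- The sum of two ideals. -/
def sup (I J : MVIdeal A) : MVIdeal A where
  carrier := {x | ∃ i ∈ I.carrier, ∃ j ∈ J.carrier, Le x (i ⊕ᴹ j)}
  zero_mem := ⟨zero, I.zero_mem, zero, J.zero_mem, zero_le _⟩
  oplus_mem := by
    rintro a b ⟨i, hi, j, hj, h⟩ ⟨i', hi', j', hj', h'⟩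
    refine ⟨i ⊕ᴹ i', I.oplus_mem hi hi', j ⊕ᴹ j', J.oplus_mem hj hj', ?_⟩
    have e : i ⊕ᴹ i' ⊕ᴹ (j ⊕ᴹ j') = i ⊕ᴹ j ⊕ᴹ (i' ⊕ᴹ j') := by
      rw [oplus_assoc, ← oplus_assoc i' j, oplus_comm i' j, oplus_assoc j, ← oplus_assoc]
    rw [e]
    exact oplus_le_oplus h h'
  down := fun ⟨i, hi, j, hj, h⟩ hb => ⟨i, hi, j, hj, le_trans hb h⟩

theorem left_subset_sup (I J : MVIdeal A) : I.carrier ⊆ (I.sup J).carrier :=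
  fun x hx => ⟨x, hx, zero, J.zero_mem, le_oplus_left _ _⟩

theorem right_subset_sup (I J : MVIdeal A) : J.carrier ⊆ (I.sup J).carrier :=
  fun x hx => ⟨zero, I.zero_mem, x, hx, le_oplus_right _ _⟩

/-- The polar of a set: the ideal of the elements orthogonal to all its members. -/
def polar (S : Set A) : MVIdeal A where
  carrier := {a | ∀ b ∈ S, Orth a b}
  zero_mem := fun b _ => zero_orth b
  oplus_mem := fun ha ha' b hb => (ha b hb).oplus_left (ha' b hb)
  down := fun ha h b hb => (ha b hb).mono_left h

theorem one_notMem {I : MVIdeal A} (h : I.carrier ≠ univ) : one ∉ I.carrier :=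
  fun h₁ => h (eq_univ_of_forall fun x => I.down h₁ (le_one x))

theorem ne_univ_of_notMem {I : MVIdeal A} {a : A} (h : a ∉ I.carrier) : I.carrier ≠ univ :=
  fun e => h (e ▸ mem_univ a)

/-- Zorn's lemma for the ideals that contain `J` and miss `S`. -/
theorem exists_maximal_disjoint (J : MVIdeal A) (S : Set A) (hJ : Disjoint J.carrier S) :
    ∃ P : MVIdeal A, J.carrier ⊆ P.carrier ∧ Disjoint P.carrier S ∧
      ∀ Q : MVIdeal A, P.carrier ⊆ Q.carrier → Disjoint Q.carrier S → Q.carrier = P.carrier := by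
  obtain ⟨m, hJm, hm⟩ := zorn_subset_nonempty
    {s : Set A | ∃ I : MVIdeal A, I.carrier = s ∧ Disjoint s S} (by
      intro c hc hchain ⟨s₀, hs₀⟩
      refine ⟨⋃₀ c, ⟨⟨⋃₀ c, ?_, ?_, ?_⟩, rfl, ?_⟩, fun s hs => subset_sUnion_of_mem hs⟩
      · obtain ⟨I, rfl, -⟩ := hc hs₀
        exact ⟨_, hs₀, I.zero_mem⟩
      · rintro a b ⟨s, hs, ha⟩ ⟨t, ht, hb⟩
        rcases hchain.total hs ht with h | h
        · obtain ⟨I, rfl, -⟩ := hc ht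
          exact ⟨_, ht, I.oplus_mem (h ha) hb⟩
        · obtain ⟨I, rfl, -⟩ := hc hs
          exact ⟨_, hs, I.oplus_mem ha (h hb)⟩
      · rintro a b ⟨s, hs, ha⟩ hba
        obtain ⟨I, rfl, -⟩ := hc hs
        exact ⟨_, hs, I.down ha hba⟩
      · rw [disjoint_sUnion_left]
        exact fun s hs => (hc hs).choose_spec.2) J.carrier ⟨J, rfl, hJ⟩
  obtain ⟨P, rfl, hP⟩ := hm.prop
  exact ⟨P, hJm, hP, fun Q hPQ hQ => (hm.le_of_ge ⟨Q, rfl, hQ⟩ hPQ).antisymm hPQ⟩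

/-- The prime ideal theorem: an ideal that misses a non-empty down-directed set `S` extends to a
prime ideal that misses `S`. -/
theorem exists_isPrime (J : MVIdeal A) {S : Set A} (hne : S.Nonempty)
    (hdir : ∀ s ∈ S, ∀ t ∈ S, ∃ r ∈ S, Le r s ∧ Le r t) (hJ : Disjoint J.carrier S) :
    ∃ P : MVIdeal A, P.IsPrime ∧ J.carrier ⊆ P.carrier ∧ Disjoint P.carrier S := by
  obtain ⟨P, hJP, hPS, hmax⟩ := exists_maximal_disjoint J S hJ
  refine ⟨P, ⟨?_, fun x y => ?_⟩, hJP, hPS⟩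
  · obtain ⟨s, hs⟩ := hne
    exact ne_univ_of_notMem fun h => disjoint_left.1 hPS h hs
  · by_contra! h
    -- An ideal containing `P` and an element outside `P` meets `S`; apply this to the sums of `P`
    -- with the polar of `y ⊖ x`, which contains `x ⊖ y`, and with its bipolar, which contains `y ⊖ x`.
    have key {Q : MVIdeal A} {u : A} (hu : u ∈ Q.carrier) (huP : u ∉ P.carrier) :
        ∃ s ∈ S, ∃ p ∈ P.carrier, ∃ q ∈ Q.carrier, Le s (p ⊕ᴹ q) := by
      by_contra! hn
      refine huP ?_
      rw [← hmax (P.sup Q) (left_subset_sup P Q) ?_]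
      · exact right_subset_sup P Q hu
      · rw [disjoint_left]
        rintro s ⟨p, hp, q, hq, hle⟩ hs
        exact hn s hs p hp q hq hle
    obtain ⟨s, hs, p, hp, q, hq, hle⟩ := key (Q := polar {ominus y x}) (u := ominus x y)
      (by rintro b rfl; exact orth_ominus x y) h.1
    obtain ⟨s', hs', p', hp', q', hq', hle'⟩ :=
      key (Q := polar (polar {ominus y x}).carrier) (u := ominus y x)
        (fun b hb => (hb _ rfl).symm) h.2
    obtain ⟨r, hr, hrs, hrs'⟩ := hdir s hs s' hs'
    have h₁ : Le (ominus r (p ⊕ᴹ p')) q := by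
      refine ominus_le_iff.2 (le_trans (le_trans hrs hle) ?_)
      exact oplus_le_oplus (le_oplus_left _ _) (le_refl _)
    have h₂ : Le (ominus r (p ⊕ᴹ p')) q' := by
      refine ominus_le_iff.2 (le_trans (le_trans hrs' hle') ?_)
      exact oplus_le_oplus (le_oplus_right _ _) (le_refl _)
    have h₃ := ominus_eq_zero_iff.1 (hq' q hq _ h₂ h₁)
    exact disjoint_left.1 hPS (P.down (P.oplus_mem hp hp') h₃) hr

/-- The prime ideal theorem for a single excluded element. -/
theorem exists_isPrime_of_notMem (J : MVIdeal A) {a : A} (ha : a ∉ J.carrier) :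
    ∃ P : MVIdeal A, P.IsPrime ∧ J.carrier ⊆ P.carrier ∧ a ∉ P.carrier := by
  obtain ⟨P, hP, hJP, hd⟩ := exists_isPrime J (singleton_nonempty a)
    (by rintro s rfl t rfl; exact ⟨_, rfl, le_refl _, le_refl _⟩) (disjoint_singleton_right.2 ha)
  exact ⟨P, hP, hJP, disjoint_singleton_right.1 hd⟩

theorem exists_isMaximal (J : MVIdeal A) (hJ : J.carrier ≠ univ) :
    ∃ M : MVIdeal A, M.IsMaximal ∧ J.carrier ⊆ M.carrier := by
  obtain ⟨M, hJM, hM, hmax⟩ :=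
    exists_maximal_disjoint J {one} (disjoint_singleton_right.2 (one_notMem hJ))
  refine ⟨M, ⟨ne_univ_of_notMem (disjoint_singleton_right.1 hM), fun Q hQ => ?_⟩, hJM⟩
  by_contra hne
  have := hmax Q hQ.subset (disjoint_singleton_right.2 (one_notMem hne))
  exact hQ.ne this.symm

theorem IsMaximal.isPrime {M : MVIdeal A} (hM : M.IsMaximal) : M.IsPrime := by
  obtain ⟨P, hP, hMP, -⟩ := exists_isPrime_of_notMem M (one_notMem hM.1)
  have : M = P := by
    ext1
    by_contra hne
    exact hP.1 (hM.2 P (hMP.ssubset_of_ne hne))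
  rwa [this]

theorem IsPrime.mem_or_mem_of_meet {P : MVIdeal A} (hP : P.IsPrime) {a b : A}
    (h : meet a b ∈ P.carrier) : a ∈ P.carrier ∨ b ∈ P.carrier := by
  rcases hP.2 a b with h' | h'
  · exact Or.inl (P.down (P.oplus_mem h' h) (le_oplus_ominus a (ominus a b)))
  · refine Or.inr (P.down (P.oplus_mem h' h) ?_)
    refine ominus_le_iff.1 (le_meet (ominus_le_iff.2 ?_) (ominus_le _ _))
    rw [oplus_comm]
    exact le_oplus_ominus b a

theorem IsPrime.mem_or_mem_of_orth {P : MVIdeal A} (hP : P.IsPrime) {a b : A} (h : Orth a b) :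
    a ∈ P.carrier ∨ b ∈ P.carrier := by
  refine hP.mem_or_mem_of_meet ?_
  rw [h _ (meet_le_left a b) (meet_le_right a b)]
  exact P.zero_mem

end MVIdeal

namespace MaxMVSpec

variable {A : Type u} [MVAlgebra A]

/-! ### The maximal spectrum and germinal ideals -/

theorem isPrime (z : MaxMVSpec A) : z.ideal.IsPrime := z.isMaximal.isPrime

theorem isOpen_setOf_notMem (a : A) : IsOpen {z : MaxMVSpec A | a ∉ z.ideal.carrier} :=
  TopologicalSpace.isOpen_generateFrom_of_mem ⟨a, rfl⟩

theorem exists_ideal_ge (J : MVIdeal A) (hJ : J.carrier ≠ univ) :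
    ∃ z : MaxMVSpec A, J.carrier ⊆ z.ideal.carrier :=
  let ⟨M, hM, hJM⟩ := J.exists_isMaximal hJ
  ⟨⟨M, hM⟩, hJM⟩

/-- An ultrafilter `F` on `Z` converges to every maximal ideal above the ideal of those `a` that
belong to `F`-almost all maximal ideals. -/
instance compactSpace : CompactSpace (MaxMVSpec A) := by
  refine ⟨isCompact_iff_ultrafilter_le_nhds.2 fun F _ => ?_⟩
  let J : MVIdeal A :=
    { carrier := {a | ∀ᶠ z : MaxMVSpec A in F, a ∈ z.ideal.carrier}
      zero_mem := Filter.Eventually.of_forall fun z => z.ideal.zero_mem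
      oplus_mem := fun ha hb => by
        filter_upwards [ha, hb] with z h₁ h₂ using z.ideal.oplus_mem h₁ h₂
      down := fun ha h => by
        filter_upwards [ha] with z h₁ using z.ideal.down h₁ h }
  have hJ : (one : A) ∉ J.carrier := fun h => by
    obtain ⟨z, hz⟩ := Filter.Eventually.exists h
    exact MVIdeal.one_notMem z.isMaximal.1 hz
  obtain ⟨z, hz⟩ := exists_ideal_ge J (MVIdeal.ne_univ_of_notMem hJ)
  refine ⟨z, mem_univ z, ?_⟩
  rw [TopologicalSpace.nhds_generateFrom]
  refine le_iInf₂ ?_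
  rintro _ ⟨hz', a, rfl⟩
  rw [Filter.le_principal_iff]
  exact Ultrafilter.eventually_not.2 fun h => hz' (hz h)

theorem exists_orth_of_ne {z w : MaxMVSpec A} (h : z ≠ w) :
    ∃ a b : A, a ∉ z.ideal.carrier ∧ b ∉ w.ideal.carrier ∧ Orth a b := by
  have aux {z w : MaxMVSpec A} (h : z ≠ w) : ∃ a ∈ w.ideal.carrier, a ∉ z.ideal.carrier := by
    by_contra! hn
    have : w.ideal = z.ideal := by
      ext1
      by_contra hne
      exact z.isMaximal.1 (w.isMaximal.2 _ (LE.le.ssubset_of_ne hn hne))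
    cases z
    cases w
    cases this
    exact h rfl
  obtain ⟨a, haw, haz⟩ := aux h
  obtain ⟨b, hbz, hbw⟩ := aux h.symm
  exact ⟨ominus a b, ominus b a,
    fun h' => haz (z.ideal.down (z.ideal.oplus_mem hbz h') (le_oplus_ominus a b)),
    fun h' => hbw (w.ideal.down (w.ideal.oplus_mem haw h') (le_oplus_ominus b a)),
    orth_ominus a b⟩

instance t2Space : T2Space (MaxMVSpec A) := by
  refine ⟨fun z w h => ?_⟩
  obtain ⟨a, b, ha, hb, hab⟩ := exists_orth_of_ne h
  refine ⟨_, _, isOpen_setOf_notMem a, isOpen_setOf_notMem b, ha, hb, ?_⟩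
  rw [disjoint_left]
  intro v hv hv'
  exact (v.isPrime.mem_or_mem_of_orth hab).elim hv hv'

theorem mem_germinal_of_orth {z : MaxMVSpec A} {a b : A} (hb : b ∉ z.ideal.carrier)
    (h : Orth a b) : a ∈ z.germinal.carrier :=
  fun _ hP hPz => (hP.mem_or_mem_of_orth h).resolve_right fun hbP => hb (hPz hbP)

/-- If `a` is orthogonal to no `b ∉ I_z`, then the meets `a ∧ b` with `b ∉ I_z` are non-zero, and a
prime ideal that misses all of them lies in `I_z` and does not contain `a`. -/
theorem mem_germinal_iff {z : MaxMVSpec A} {a : A} :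
    a ∈ z.germinal.carrier ↔ ∃ b, b ∉ z.ideal.carrier ∧ Orth a b := by
  refine ⟨fun ha => ?_, fun ⟨b, hb, h⟩ => mem_germinal_of_orth hb h⟩
  by_contra! hn
  have hone : (one : A) ∉ z.ideal.carrier := MVIdeal.one_notMem z.isMaximal.1
  obtain ⟨P, hP, -, hd⟩ := MVIdeal.exists_isPrime (MVIdeal.bot : MVIdeal A)
    (S := meet a '' {b | b ∉ z.ideal.carrier}) ⟨_, one, hone, rfl⟩ (by
      rintro _ ⟨b, hb, rfl⟩ _ ⟨c, hc, rfl⟩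
      have hbc : meet b c ∉ z.ideal.carrier :=
        fun h => (z.isPrime.mem_or_mem_of_meet h).elim hb hc
      exact ⟨_, ⟨meet b c, hbc, rfl⟩,
        le_meet (meet_le_left _ _) (le_trans (meet_le_right _ _) (meet_le_left _ _)),
        le_meet (meet_le_left _ _) (le_trans (meet_le_right _ _) (meet_le_right _ _))⟩) (by
      rw [disjoint_right]
      rintro _ ⟨b, hb, rfl⟩ h
      exact hn b hb (orth_of_meet_eq_zero h))
  have hPS {b : A} (hb : b ∉ z.ideal.carrier) : meet a b ∉ P.carrier :=
    fun h => disjoint_left.1 hd h ⟨b, hb, rfl⟩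
  refine hPS hone (P.down (ha P hP fun b hbP => ?_) (meet_le_left _ _))
  by_contra hb
  exact hPS hb (P.down hbP (meet_le_right _ _))

theorem eventually_mem_germinal {z : MaxMVSpec A} {a : A} (h : a ∈ z.germinal.carrier) :
    ∀ᶠ w in 𝓝 z, a ∈ w.germinal.carrier := by
  obtain ⟨b, hb, hab⟩ := mem_germinal_iff.1 h
  filter_upwards [(isOpen_setOf_notMem b).mem_nhds hb] with w hw using mem_germinal_of_orth hw hab

theorem eq_zero_of_forall_mem_germinal {a : A} (h : ∀ z : MaxMVSpec A, a ∈ z.germinal.carrier) :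
    a = zero := by
  by_contra ha
  obtain ⟨P, hP, -, haP⟩ := MVIdeal.exists_isPrime_of_notMem (MVIdeal.bot : MVIdeal A) ha
  obtain ⟨z, hz⟩ := exists_ideal_ge P hP.1
  exact haP (h z P hP hz)

/-! ### Gluing over closed sets -/

/-- The ideal `I_K` of the elements whose germs vanish at all points of `K`. -/
def vanishing (K : Set (MaxMVSpec A)) : MVIdeal A where
  carrier := {a | ∀ z ∈ K, a ∈ z.germinal.carrier}
  zero_mem := fun z _ => z.germinal.zero_mem
  oplus_mem := fun ha hb z hz => z.germinal.oplus_mem (ha z hz) (hb z hz)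
  down := fun ha h z hz => z.germinal.down (ha z hz) h

theorem exists_mem_germinal_of_isClosed {K : Set (MaxMVSpec A)} (hK : IsClosed K)
    {z : MaxMVSpec A} (hz : z ∉ K) : ∃ v ∈ (vanishing K).carrier, v ∉ z.ideal.carrier := by
  refine hK.isCompact.induction_on (p := fun s => ∃ v ∈ (vanishing s).carrier, v ∉ z.ideal.carrier)
    ⟨one, fun w hw => hw.elim, MVIdeal.one_notMem z.isMaximal.1⟩ ?_ ?_ ?_
  · rintro s t hst ⟨v, hv, hvz⟩
    exact ⟨v, fun w hw => hv w (hst hw), hvz⟩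
  · rintro s t ⟨v, hv, hvz⟩ ⟨v', hv', hvz'⟩
    refine ⟨meet v v', ?_, fun h => (z.isPrime.mem_or_mem_of_meet h).elim hvz hvz'⟩
    rintro w (hw | hw)
    · exact w.germinal.down (hv w hw) (meet_le_left _ _)
    · exact w.germinal.down (hv' w hw) (meet_le_right _ _)
  · intro w hw
    obtain ⟨u, v, hu, hv, huv⟩ := exists_orth_of_ne (z := w) (w := z) fun h => hz (h ▸ hw)
    exact ⟨_, mem_nhdsWithin_of_mem_nhds ((isOpen_setOf_notMem u).mem_nhds hu), v,
      fun x hx => mem_germinal_of_orth hx huv.symm, hv⟩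

/-- `I_{K ∩ L}` is contained in `I_K + I_L`. -/
theorem vanishing_inter_subset {K L : Set (MaxMVSpec A)} (hK : IsClosed K) (hL : IsClosed L) :
    (vanishing (K ∩ L)).carrier ⊆ ((vanishing K).sup (vanishing L)).carrier := by
  intro d hd
  by_contra hn
  obtain ⟨P, hP, hle, hdP⟩ := MVIdeal.exists_isPrime_of_notMem _ hn
  obtain ⟨z, hz⟩ := exists_ideal_ge P hP.1
  have mem {M : Set (MaxMVSpec A)} (hM : IsClosed M) (hMP : (vanishing M).carrier ⊆ P.carrier) :
      z ∈ M := by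
    by_contra hzM
    obtain ⟨v, hv, hvz⟩ := exists_mem_germinal_of_isClosed hM hzM
    exact hvz (hz (hMP hv))
  have hzK := mem hK ((MVIdeal.left_subset_sup _ _).trans hle)
  have hzL := mem hL ((MVIdeal.right_subset_sup _ _).trans hle)
  exact hdP (hd z ⟨hzK, hzL⟩ P hP hz)

end MaxMVSpec

namespace GermSpace

variable {A : Type u} [MVAlgebra A]

theorem ofElem_eq_iff {a b : A} {z : MaxMVSpec A} :
    ofElem a z = ofElem b z ↔
      ominus a b ∈ z.germinal.carrier ∧ ominus b a ∈ z.germinal.carrier :=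
  Quotient.eq (r := z.germinal.congr)

theorem exists_ofElem_eq (z : MaxMVSpec A) (e : z.Fibre) : ∃ a : A, ofElem a z = e :=
  Quotient.exists_rep e

theorem ofElem_eq_of_le {a b i : A} {z : MaxMVSpec A} (hi : i ∈ z.germinal.carrier)
    (hab : Le a (b ⊕ᴹ i)) (hba : Le b (a ⊕ᴹ i)) : ofElem a z = ofElem b z :=
  ofElem_eq_iff.2 ⟨z.germinal.down hi (ominus_le_iff.2 hab),
    z.germinal.down hi (ominus_le_iff.2 hba)⟩

end GermSpace

open GermSpace

/-- The Chinese remainder theorem for `I_K` and `I_L`. -/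
theorem MaxMVSpec.exists_glue {A : Type u} [MVAlgebra A] {K L : Set (MaxMVSpec A)}
    (hK : IsClosed K) (hL : IsClosed L) {a b : A} (h : ∀ z ∈ K ∩ L, ofElem a z = ofElem b z) :
    ∃ c : A, (∀ z ∈ K, ofElem c z = ofElem a z) ∧ ∀ z ∈ L, ofElem c z = ofElem b z := by
  have hab : ominus a b ⊕ᴹ ominus b a ∈ ((vanishing K).sup (vanishing L)).carrier :=
    vanishing_inter_subset hK hL fun z hz =>
      z.germinal.oplus_mem (ofElem_eq_iff.1 (h z hz)).1 (ofElem_eq_iff.1 (h z hz)).2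
  obtain ⟨i, hi, j, hj, hij⟩ := hab
  have h₁ : Le a (b ⊕ᴹ (i ⊕ᴹ j)) := ominus_le_iff.1 (le_trans (le_oplus_left _ _) hij)
  have h₂ : Le b (a ⊕ᴹ (i ⊕ᴹ j)) := ominus_le_iff.1 (le_trans (le_oplus_right _ _) hij)
  refine ⟨join (ominus a i) (ominus b j), fun z hz => ofElem_eq_of_le (hi z hz) ?_ ?_,
    fun z hz => ofElem_eq_of_le (hj z hz) ?_ ?_⟩
  · refine join_le (le_trans (ominus_le a i) (le_oplus_left a i)) (ominus_le_iff.2 ?_)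
    rwa [oplus_comm j, oplus_assoc]
  · rw [oplus_comm]
    exact ominus_le_iff.1 (le_join_left _ _)
  · refine join_le (ominus_le_iff.2 ?_) (le_trans (ominus_le b j) (le_oplus_left b j))
    rwa [oplus_comm i, oplus_assoc, oplus_comm j]
  · rw [oplus_comm]
    exact ominus_le_iff.1 (le_join_right _ _)

namespace GermSpace

variable {A : Type u} [MVAlgebra A]

/-! ### The étale space -/

theorem eventually_ofElem_eq {a b : A} {z : MaxMVSpec A} (h : ofElem a z = ofElem b z) :
    ∀ᶠ w in 𝓝 z, ofElem a w = ofElem b w := by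
  obtain ⟨h₁, h₂⟩ := ofElem_eq_iff.1 h
  filter_upwards [MaxMVSpec.eventually_mem_germinal h₁, MaxMVSpec.eventually_mem_germinal h₂]
    with w h₃ h₄ using ofElem_eq_iff.2 ⟨h₃, h₄⟩

theorem toSection_mem_image {f g : ∀ z : MaxMVSpec A, z.Fibre} {U : Set (MaxMVSpec A)}
    {z : MaxMVSpec A} : toSection f z ∈ toSection g '' U ↔ z ∈ U ∧ f z = g z := by
  constructor
  · rintro ⟨w, hw, h⟩
    cases congrArg base h
    have h' : g z = f z := by
      unfold toSection at h
      injection h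
    exact ⟨hw, h'.symm⟩
  · rintro ⟨hz, h⟩
    exact ⟨z, hz, by rw [toSection, toSection, h]⟩

theorem isOpen_image (a : A) {U : Set (MaxMVSpec A)} (hU : IsOpen U) :
    IsOpen (toSection (ofElem a) '' U) :=
  TopologicalSpace.isOpen_generateFrom_of_mem ⟨a, U, hU, rfl⟩

theorem continuous_ofElem (a : A) : Continuous (toSection (ofElem a)) := by
  refine continuous_generateFrom_iff.2 ?_
  rintro _ ⟨b, U, hU, rfl⟩
  rw [isOpen_iff_mem_nhds]
  intro z hz
  obtain ⟨hzU, h⟩ := toSection_mem_image.1 hz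
  filter_upwards [hU.mem_nhds hzU, eventually_ofElem_eq h] with w h₁ h₂
    using toSection_mem_image.2 ⟨h₁, h₂⟩

theorem continuous_base : Continuous (base : GermSpace A → MaxMVSpec A) := by
  refine continuous_def.2 fun U hU => ?_
  have : base ⁻¹' U = ⋃ a : A, toSection (ofElem a) '' U := by
    ext ⟨z, e⟩
    obtain ⟨a, rfl⟩ := exists_ofElem_eq z e
    refine ⟨fun h => mem_iUnion.2 ⟨a, z, h, rfl⟩, fun h => ?_⟩
    obtain ⟨b, w, hw, h⟩ := mem_iUnion.1 h
    rw [← h]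
    exact hw
  rw [this]
  exact isOpen_iUnion fun a => isOpen_image a hU

/-- The projection restricts to a homeomorphism from the image of `s_a` onto `Z`. -/
def chart (a : A) : OpenPartialHomeomorph (GermSpace A) (MaxMVSpec A) where
  toFun := base
  invFun := toSection (ofElem a)
  source := toSection (ofElem a) '' univ
  target := univ
  map_source' := fun _ _ => mem_univ _
  map_target' := fun z hz => ⟨z, hz, rfl⟩
  left_inv' := by
    rintro _ ⟨z, -, rfl⟩
    rfl
  right_inv' := fun _ _ => rfl
  open_source := isOpen_image a isOpen_univ
  open_target := isOpen_univ
  continuousOn_toFun := continuous_base.continuousOn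
  continuousOn_invFun := (continuous_ofElem a).continuousOn

theorem isLocalHomeomorph_base : IsLocalHomeomorph (base : GermSpace A → MaxMVSpec A) := by
  rintro ⟨z, e⟩
  obtain ⟨a, rfl⟩ := exists_ofElem_eq z e
  exact ⟨chart a, ⟨z, mem_univ z, rfl⟩, rfl⟩

/-! ### Continuous sections -/

/-- The continuous sections over an open set are the families that are locally given by elements
of `A`. -/
theorem isSectionOn_iff {U : Set (MaxMVSpec A)} (hU : IsOpen U)
    {f : ∀ z : MaxMVSpec A, z.Fibre} :
    IsSectionOn U f ↔ ∀ z ∈ U, ∃ a : A, ∀ᶠ w in 𝓝 z, f w = ofElem a w := by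
  constructor
  · intro hf z hz
    obtain ⟨a, ha⟩ := exists_ofElem_eq z (f z)
    refine ⟨a, ?_⟩
    have := (hf.continuousAt (hU.mem_nhds hz)).preimage_mem_nhds
      ((isOpen_image a isOpen_univ).mem_nhds (toSection_mem_image.2 ⟨mem_univ z, ha.symm⟩))
    filter_upwards [this] with w hw using (toSection_mem_image.1 hw).2
  · intro h z hz
    obtain ⟨a, ha⟩ := h z hz
    refine ((continuous_ofElem a).continuousAt.congr ?_).continuousWithinAt
    filter_upwards [ha] with w hw
    rw [toSection, toSection, hw]

/-- The subalgebra of the families whose restriction to `U` is a continuous section. -/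
def sections (U : Set (MaxMVSpec A)) (hU : IsOpen U) :
    MVSubalgebra (∀ z : MaxMVSpec A, z.Fibre) where
  carrier := {f | IsSectionOn U f}
  zero_mem := (continuous_ofElem (zero : A)).continuousOn
  oplus_mem := by
    intro f g hf hg
    refine (isSectionOn_iff hU).2 fun z hz => ?_
    obtain ⟨a, ha⟩ := (isSectionOn_iff hU).1 hf z hz
    obtain ⟨b, hb⟩ := (isSectionOn_iff hU).1 hg z hz
    refine ⟨a ⊕ᴹ b, ?_⟩
    filter_upwards [ha, hb] with w h₁ h₂
    change f w ⊕ᴹ g w = _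
    rw [h₁, h₂]
    rfl
  neg_mem := by
    intro f hf
    refine (isSectionOn_iff hU).2 fun z hz => ?_
    obtain ⟨a, ha⟩ := (isSectionOn_iff hU).1 hf z hz
    refine ⟨∼ᴹa, ?_⟩
    filter_upwards [ha] with w h₁
    change ∼ᴹ(f w) = _
    rw [h₁]
    rfl

theorem eventually_eq_of_isSectionOn {U V : Set (MaxMVSpec A)} {f g : ∀ w : MaxMVSpec A, w.Fibre}
    {z : MaxMVSpec A} (hU : IsOpen U) (hzU : z ∈ U) (hf : IsSectionOn U f)
    (hV : IsOpen V) (hzV : z ∈ V) (hg : IsSectionOn V g) (h : f z = g z) :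
    ∀ᶠ w in 𝓝 z, f w = g w := by
  obtain ⟨a, ha⟩ := (isSectionOn_iff hU).1 hf z hzU
  obtain ⟨b, hb⟩ := (isSectionOn_iff hV).1 hg z hzV
  have hab : ofElem a z = ofElem b z := by rw [← ha.self_of_nhds, ← hb.self_of_nhds, h]
  filter_upwards [ha, hb, eventually_ofElem_eq hab] with w h₁ h₂ h₃
  rw [h₁, h₂, h₃]

theorem ofElem_injective :
    Function.Injective (ofElem : A → ∀ z : MaxMVSpec A, z.Fibre) := by
  intro a b h
  have h' (z : MaxMVSpec A) := ofElem_eq_iff.1 (congrFun h z)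
  exact le_antisymm
    (ominus_eq_zero_iff.1 (MaxMVSpec.eq_zero_of_forall_mem_germinal fun z => (h' z).1))
    (ominus_eq_zero_iff.1 (MaxMVSpec.eq_zero_of_forall_mem_germinal fun z => (h' z).2))

theorem exists_ofElem_of_continuous {f : ∀ z : MaxMVSpec A, z.Fibre}
    (hf : Continuous (toSection f)) : ∃ a : A, ofElem a = f := by
  have hloc := (isSectionOn_iff isOpen_univ).1 hf.continuousOn
  -- Closures appear because gluing needs closed sets.
  obtain ⟨a, ha⟩ := isCompact_univ.induction_on
    (p := fun s => ∃ a : A, ∀ z ∈ closure s, ofElem a z = f z)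
    ⟨zero, fun z hz => by simp at hz⟩
    (fun s t hst ⟨a, ha⟩ => ⟨a, fun z hz => ha z (closure_mono hst hz)⟩)
    (by
      rintro s t ⟨a, ha⟩ ⟨b, hb⟩
      obtain ⟨c, hcs, hct⟩ := MaxMVSpec.exists_glue (isClosed_closure (s := s))
        (isClosed_closure (s := t)) fun z hz => (ha z hz.1).trans (hb z hz.2).symm
      refine ⟨c, fun z hz => ?_⟩
      rw [closure_union] at hz
      rcases hz with hz | hz
      · exact (hcs z hz).trans (ha z hz)
      · exact (hct z hz).trans (hb z hz))
    (by
      intro z hz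
      obtain ⟨a, ha⟩ := hloc z hz
      obtain ⟨t, ht, htc, hta⟩ := exists_mem_nhds_isClosed_subset ha
      refine ⟨t, mem_nhdsWithin_of_mem_nhds ht, a, fun w hw => ?_⟩
      rw [htc.closure_eq] at hw
      exact (hta hw).symm)
  exact ⟨a, funext fun z => ha z (subset_closure (mem_univ z))⟩

theorem mem_sections_univ {f : ∀ z : MaxMVSpec A, z.Fibre} :
    f ∈ (sections univ isOpen_univ).carrier ↔ Continuous (toSection f) :=
  continuousOn_univ

/-- The isomorphism `a ↦ s_a` from `A` onto the algebra of continuous global sections. -/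
noncomputable def equivGlobalSections :
    MVEquiv A (sections (univ : Set (MaxMVSpec A)) isOpen_univ).carrier where
  toEquiv := Equiv.ofBijective
    (fun a => ⟨ofElem a, mem_sections_univ.2 (continuous_ofElem a)⟩)
    ⟨fun _ _ h => ofElem_injective (congrArg Subtype.val h), fun ⟨_, hf⟩ =>
      let ⟨a, ha⟩ := exists_ofElem_of_continuous (mem_sections_univ.1 hf)
      ⟨a, Subtype.ext ha⟩⟩
  map_oplus := fun _ _ => rfl
  map_neg := fun _ => rfl
  map_zero := rfl

end GermSpace

/-- For every MV-algebra `A`: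
the maximal MV-spectrum is compact Hausdorff; `GermSpace.base` is a local homeomorphism;
the continuous sections over each open set are closed under the MV-operations; the stalk at `z`
(germs at `z` of continuous sections over open neighbourhoods of `z`) is `A/𝔬_z`, through
evaluation at `z`; and the continuous global sections form an MV-subalgebra of `∏ A/𝔬_z` to which
`A` is isomorphic through `a ↦ s_a`. -/
theorem corollary8p9 {A : Type u} [MVAlgebra A] :
    CompactSpace (MaxMVSpec A) ∧ T2Space (MaxMVSpec A) ∧
    IsLocalHomeomorph (GermSpace.base : GermSpace A → MaxMVSpec A) ∧
    (∀ U : Set (MaxMVSpec A), IsOpen U →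
      ∃ S : MVSubalgebra (∀ z : MaxMVSpec A, z.Fibre),
        ∀ f, f ∈ S.carrier ↔ GermSpace.IsSectionOn U f) ∧
    (∀ z : MaxMVSpec A,
      (∀ e : z.Fibre, ∃ (U : Set (MaxMVSpec A)) (f : ∀ w : MaxMVSpec A, w.Fibre),
        IsOpen U ∧ z ∈ U ∧ GermSpace.IsSectionOn U f ∧ f z = e) ∧
      (∀ (U V : Set (MaxMVSpec A)) (f g : ∀ w : MaxMVSpec A, w.Fibre),
        IsOpen U → z ∈ U → GermSpace.IsSectionOn U f →
        IsOpen V → z ∈ V → GermSpace.IsSectionOn V g →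
        (f z = g z ↔
          ∃ W : Set (MaxMVSpec A), IsOpen W ∧ z ∈ W ∧ W ⊆ U ∩ V ∧ ∀ w ∈ W, f w = g w))) ∧
    ∃ Γ : MVSubalgebra (∀ z : MaxMVSpec A, z.Fibre),
      (∀ f, f ∈ Γ.carrier ↔ Continuous (GermSpace.toSection f)) ∧
      ∃ η : MVEquiv A Γ.carrier, ∀ a : A, (η.toFun a).1 = GermSpace.ofElem a := by
  refine ⟨MaxMVSpec.compactSpace, MaxMVSpec.t2Space, isLocalHomeomorph_base,
    fun U hU => ⟨sections U hU, fun f => Iff.rfl⟩, fun z => ⟨fun e => ?_, ?_⟩,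
    sections univ isOpen_univ, fun f => mem_sections_univ, equivGlobalSections, fun a => rfl⟩
  · obtain ⟨a, ha⟩ := exists_ofElem_eq z e
    exact ⟨univ, ofElem a, isOpen_univ, mem_univ z, (continuous_ofElem a).continuousOn, ha⟩
  · intro U V f g hU hzU hf hV hzV hg
    refine ⟨fun h => ?_, fun ⟨W, _, hzW, _, h⟩ => h z hzW⟩
    obtain ⟨W, hW, hWo, hzW⟩ :=
      eventually_nhds_iff.1 (eventually_eq_of_isSectionOn hU hzU hf hV hzV hg h)
    exact ⟨W ∩ (U ∩ V), hWo.inter (hU.inter hV), ⟨hzW, hzU, hzV⟩, inter_subset_right,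
      fun w hw => hW w hw.1⟩
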